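/- Let $H \subset \mathbb{R}^n$ be finite. For $S \subseteq \mathbb{R}^n$ and $x \in \mathbb{R}^n$ let $A_S(x) = (\mathrm{sign}\langle x,h\rangle : h \in S) \in \{-,0,+\}^S$, and let $S-S=\{h'-h'' : h',h''\in S\}$. We say that $S$ infers $h \in \mathbb{R}^n$ at $x$ if $\mathrm{sign}\langle x',h\rangle=\mathrm{sign}\langle x,h\rangle$ for all $x'\in\mathbb{R}^n$ with $A_{S\cup(S-S)}(x')=A_{S\cup(S-S)}(x)$. The inference dimension of $H$ is the minimal integer $d\ge 1$ such that for every $S\subseteq H$ with $|S|\ge d$ and every $x\in\mathbb{R}^n$ there is $h\in S$ such that $S\setminus\{h\}$ infers $h$ at $x$. A comparison decision tree for $A_H$ is a finite ternary decision tree each of whose inner nodes queries $\mathrm{sign}\langle q,x\rangle$ for some $q\in H\cup(H-H)$ and branches on the answer, and whose output is $A_H(x)$ for every input $x\in\mathbb{R}^n$. A zero-error randomized comparison decision tree computing $A_H$ is a probability distribution over such trees $T$; its expected query complexity is the maximum over $x\in\mathbb{R}^n$ of the expected number of queries performed by $T$ on $x$. **Theorem.** There is an absolute constant $C>0$ such that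 for every $n$ and every finite $H\subset\mathbb{R}^n$ with $|H|\ge 2$ and inference dimension $d$, there exists a zero-error randomized comparison decision tree which computes $A_H$ and whose expected query complexity is at most $C\,(d+n\log d)\log|H|$. -/

import Mathlib

open scoped Pointwise ENNReal

namespace PointLocation

noncomputable section

/-- The space `ℝⁿ` with its standard inner product. -/
abbrev Vec (n : ℕ) : Type := EuclideanSpace ℝ (Fin n)

/-- The point-location function `A_S(x) = (sign ⟪x, h⟫ : h ∈ S)`; `SignType` is `{-, 0, +}`. -/
def signPattern {n : ℕ} (S : Set (Vec n)) (x : Vec n) : S → SignType :=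
  fun h => SignType.sign (inner ℝ x (h : Vec n))

/-- `P_S(x)`: the points that give the same answers as `x` to all label queries and all
comparison queries on `S`. Here `S - S = {h' - h'' : h', h'' ∈ S}`. -/
def cell {n : ℕ} (S : Set (Vec n)) (x : Vec n) : Set (Vec n) :=
  {x' | signPattern (S ∪ (S - S)) x' = signPattern (S ∪ (S - S)) x}

/-- `S` infers `h` at `x`. -/
def Infers {n : ℕ} (S : Set (Vec n)) (h x : Vec n) : Prop :=
  ∀ x' ∈ cell S x, SignType.sign (inner ℝ x' h) = SignType.sign (inner ℝ x h)

/-- The inference dimension of `H` is `d`: `d` is the least integer `≥ 1` such that for every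
`S ⊆ H` with at least `d` elements (possibly infinite) and every `x`, some `h ∈ S` is inferred
at `x` by `S \ {h}`. -/
def IsInferenceDimension {n : ℕ} (H : Set (Vec n)) (d : ℕ) : Prop :=
  IsLeast {k : ℕ | 1 ≤ k ∧ ∀ S : Set (Vec n), S ⊆ H → (k : ℕ∞) ≤ S.encard →
    ∀ x : Vec n, ∃ h ∈ S, Infers (S \ {h}) h x} d

/-- Linear decision trees on inputs `x ∈ ℝⁿ`: a leaf carries an output, and an inner node queries
`sign ⟪q, x⟫` and branches on the answer. -/
inductive LinearDecisionTree (n : ℕ) (α : Type) : Type where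
  | leaf (output : α) : LinearDecisionTree n α
  | node (q : Vec n) (child : SignType → LinearDecisionTree n α) : LinearDecisionTree n α

namespace LinearDecisionTree

variable {n : ℕ} {α : Type}

/-- The output of the tree on input `x`. -/
def eval : LinearDecisionTree n α → Vec n → α
  | leaf a, _ => a
  | node q child, x => (child (SignType.sign (inner ℝ q x))).eval x

/-- The number of queries that the tree performs on input `x`. -/
def numQueries : LinearDecisionTree n α → Vec n → ℕ
  | leaf _, _ => 0
  | node q child, x => (child (SignType.sign (inner ℝ q x))).numQueries x + 1

/-- Every query of the tree belongs to `Q`. -/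
def QueriesIn (Q : Set (Vec n)) : LinearDecisionTree n α → Prop
  | leaf _ => True
  | node q child => q ∈ Q ∧ ∀ s, (child s).QueriesIn Q

/-- A comparison tree for `H`: each query is a label query (`h ∈ H`) or a comparison query
(`h' - h''` with `h', h'' ∈ H`). -/
def IsComparison (H : Set (Vec n)) (T : LinearDecisionTree n α) : Prop :=
  T.QueriesIn (H ∪ (H - H))

/-- The tree computes `A_H(x)` correctly on all inputs `x`. -/
def Computes (H : Set (Vec n)) (T : LinearDecisionTree n (H → SignType)) : Prop :=
  ∀ x, T.eval x = signPattern H x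

end LinearDecisionTree

/-- A zero-error randomized comparison decision tree for `A_H`: a probability distribution over
deterministic comparison decision trees, each of which computes `A_H` correctly on all inputs.
For finite `H` there are only countably many comparison trees, so that discrete distributions are
all distributions. -/
structure ZeroErrorComparisonTree {n : ℕ} (H : Set (Vec n)) where
  dist : PMF (LinearDecisionTree n (H → SignType))
  isComparison : ∀ T ∈ dist.support, T.IsComparison H
  computes : ∀ T ∈ dist.support, T.Computes H

/-- The expected number of queries on input `x`. -/
def ZeroErrorComparisonTree.expectedQueries {n : ℕ} {H : Set (Vec n)}
    (R : ZeroErrorComparisonTree H) (x : Vec n) : ℝ≥0∞ :=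
  ∑' T : LinearDecisionTree n (H → SignType), R.dist T * (T.numQueries x : ℝ≥0∞)

/-- The expected query complexity: the maximum over the inputs of the expected number of queries. -/
def ZeroErrorComparisonTree.expectedQueryComplexity {n : ℕ} {H : Set (Vec n)}
    (R : ZeroErrorComparisonTree H) : ℝ≥0∞ :=
  ⨆ x : Vec n, R.expectedQueries x

end

end PointLocation

/-! The signs are found in rounds: sort a random sample `S` of at most `2 d` undetermined elements,
read off every sign that `S` infers, and recurse on the rest.

A round is effective because in any `U ⊆ H` fewer than `d` elements are not inferred by the others
(`card_filter_not_infers_lt`). A random `2 d`-set with one further random element is a random `(2 d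
+ 1)`-set with a random marked element, so a sample leaves at most half of the elements in
expectation (`two_mul_sum_card_notInferred_le`). By concavity the potential `log (1 + |G|)` then
drops by at least `1 / 4` on average, and `4 K log (1 + |G|)` pays for rounds of cost `K`
(`exists_random_tree`).

A round is cheap because `S ∪ (S - S)` defines only `d ^ O(n)` faces (`exists_representatives`), far
fewer than all orders. Insertion sort with binary search weighted by the faces still possible uses
at most two queries either to place an element or to halve the set of faces (`narrows_insert`).
Halvings are paid for by the logarithm of the number of faces, so `K = O(d + n log d)` instead of
`O(d log d)`. -/

namespace PointLocation

/-! ### Counting the faces of a hyperplane arrangement -/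

/-- `x` and `y` give the same answer to every query in `Q`. -/
def AgreeOn {n : ℕ} (Q : Set (Vec n)) (x y : Vec n) : Prop :=
  ∀ q ∈ Q, SignType.sign (inner ℝ q x) = SignType.sign (inner ℝ q y)

namespace AgreeOn

variable {n : ℕ} {Q Q' : Set (Vec n)} {x y z : Vec n}

theorem symm (h : AgreeOn Q x y) : AgreeOn Q y x := fun q hq => (h q hq).symm

theorem trans (h : AgreeOn Q x y) (h' : AgreeOn Q y z) : AgreeOn Q x z :=
  fun q hq => (h q hq).trans (h' q hq)

theorem mono (h : AgreeOn Q x y) (hQ : Q' ⊆ Q) : AgreeOn Q' x y := fun q hq => h q (hQ hq)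

theorem union (h : AgreeOn Q x y) (h' : AgreeOn Q' x y) : AgreeOn (Q ∪ Q') x y :=
  fun q hq => hq.elim (h q) (h' q)

end AgreeOn

/-- Faces are convex. -/
theorem sign_convexComb_eq {a b t : ℝ} (ht0 : 0 ≤ t) (ht1 : t ≤ 1)
    (h : SignType.sign a = SignType.sign b) :
    SignType.sign ((1 - t) * a + t * b) = SignType.sign a := by
  rcases lt_trichotomy a 0 with ha | ha | ha
  · rw [sign_neg ha] at h ⊢
    have hb : b < 0 := sign_eq_neg_one_iff.mp h.symm
    apply sign_neg
    rcases ht1.lt_or_eq with h1 | h1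
    · nlinarith
    · subst h1; simpa using hb
  · subst ha
    rw [sign_zero] at h ⊢
    rw [sign_eq_zero_iff.mp h.symm]; simp
  · rw [sign_pos ha] at h ⊢
    have hb : 0 < b := sign_eq_one_iff.mp h.symm
    apply sign_pos
    rcases ht1.lt_or_eq with h1 | h1
    · nlinarith
    · subst h1; simpa using hb

theorem exists_convexComb_eq_zero {a b : ℝ} (h : SignType.sign a ≠ SignType.sign b) :
    ∃ t : ℝ, 0 ≤ t ∧ t ≤ 1 ∧ (1 - t) * a + t * b = 0 := by
  have key : ∀ a b : ℝ, a ≤ 0 → 0 ≤ b → a ≠ b →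
      ∃ t : ℝ, 0 ≤ t ∧ t ≤ 1 ∧ (1 - t) * a + t * b = 0 := by
    intro a b ha hb hab
    have hd : 0 < b - a := by
      rcases (ha.trans hb).lt_or_eq with h | h
      · linarith
      · exact absurd h hab
    refine ⟨-a / (b - a), div_nonneg (by linarith) hd.le, ?_, ?_⟩
    · rw [div_le_one hd]; linarith
    · field_simp; ring
  have hab : a ≠ b := fun e => h (by rw [e])
  rcases le_total a 0 with ha | ha <;> rcases le_total b 0 with hb | hb
  · rcases ha.lt_or_eq with ha' | ha'
    · rcases hb.lt_or_eq with hb' | hb'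
      · exact absurd ((sign_neg ha').trans (sign_neg hb').symm) h
      · exact key a b ha hb'.ge hab
    · exact ⟨0, le_rfl, zero_le_one, by simp [ha']⟩
  · exact key a b ha hb hab
  · obtain ⟨t, h0, h1, ht⟩ := key b a hb ha hab.symm
    exact ⟨1 - t, by linarith, by linarith, by linarith⟩
  · rcases ha.lt_or_eq with ha' | ha'
    · rcases hb.lt_or_eq with hb' | hb'
      · exact absurd ((sign_pos ha').trans (sign_pos hb').symm) h
      · exact ⟨1, zero_le_one, le_rfl, by simp [← hb']⟩
    · exact ⟨0, le_rfl, zero_le_one, by simp [← ha']⟩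

/-- The arrangement of the hyperplanes orthogonal to the vectors of `Q` cuts a subspace `V` into at
most `(3 |Q| + 1) ^ dim V` faces. -/
theorem exists_representatives {n : ℕ} (Q : Finset (Vec n)) :
    ∀ V : Submodule ℝ (Vec n), ∃ X : Finset (Vec n), (∀ x ∈ X, x ∈ V) ∧
      X.card ≤ (3 * Q.card + 1) ^ Module.finrank ℝ V ∧
      ∀ v ∈ V, ∃ x ∈ X, AgreeOn (Q : Set (Vec n)) v x := by
  classical
  induction Q using Finset.induction_on with
  | empty =>
    intro V
    refine ⟨{0}, by simp, by simp, fun v _ => ⟨0, by simp, fun q hq => by simp at hq⟩⟩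
  | insert h Q hQ ih =>
    intro V
    obtain ⟨X, hXV, hXc, hX⟩ := ih V
    by_cases hV : ∀ v ∈ V, inner ℝ h v = 0
    · refine ⟨X, hXV, hXc.trans (Nat.pow_le_pow_left ?_ _), fun v hv => ?_⟩
      · rw [Finset.card_insert_of_notMem hQ]; omega
      · obtain ⟨x, hx, hvx⟩ := hX v hv
        refine ⟨x, hx, fun q hq => ?_⟩
        rcases Finset.mem_insert.mp (Finset.mem_coe.mp hq) with rfl | hq
        · rw [hV v hv, hV x (hXV x hx)]
        · exact hvx q hq
    · push Not at hV
      obtain ⟨v₀, hv₀, hv₀'⟩ := hV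
      set V' : Submodule ℝ (Vec n) := V ⊓ LinearMap.ker (innerSL ℝ h).toLinearMap with hV'
      have hmem : ∀ w, w ∈ V' ↔ w ∈ V ∧ inner ℝ h w = 0 := by
        intro w; simp [hV']
      have hlt : V' < V := by
        refine lt_of_le_of_ne inf_le_left fun e => hv₀' ?_
        rw [← e] at hv₀
        exact ((hmem _).mp hv₀).2
      have hrank := Submodule.finrank_lt_finrank_of_lt hlt
      obtain ⟨X', hXV', hXc', hX'⟩ := ih V'
      -- One point is chosen in each nonempty piece into which `h` cuts the face of `x`; the default
      -- `x` stands for an empty piece.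
      have hf : ∀ (s : SignType) (x : Vec n), ∃ y : Vec n, x ∈ V → y ∈ V ∧
          ((∃ v ∈ V, AgreeOn (Q : Set (Vec n)) v x ∧ SignType.sign (inner ℝ h v) = s) →
            AgreeOn (Q : Set (Vec n)) y x ∧ SignType.sign (inner ℝ h y) = s) := by
        intro s x
        by_cases hs : ∃ v ∈ V, AgreeOn (Q : Set (Vec n)) v x ∧ SignType.sign (inner ℝ h v) = s
        · obtain ⟨v, hv, h1, h2⟩ := hs
          exact ⟨v, fun _ => ⟨hv, fun _ => ⟨h1, h2⟩⟩⟩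
        · exact ⟨x, fun hx => ⟨hx, fun h' => absurd h' hs⟩⟩
      choose f hf using hf
      refine ⟨X ∪ (X'.image (f (-1)) ∪ (X'.image (f 0) ∪ X'.image (f 1))), ?_, ?_, ?_⟩
      · intro x hx
        simp only [Finset.mem_union, Finset.mem_image] at hx
        rcases hx with hx | ⟨y, hy, rfl⟩ | ⟨y, hy, rfl⟩ | ⟨y, hy, rfl⟩
        · exact hXV x hx
        all_goals exact (hf _ y ((hmem y).mp (hXV' y hy)).1).1
      · have hc : (X ∪ (X'.image (f (-1)) ∪ (X'.image (f 0) ∪ X'.image (f 1)))).card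
            ≤ X.card + 3 * X'.card := by
          have h1 := Finset.card_union_le X (X'.image (f (-1)) ∪ (X'.image (f 0) ∪ X'.image (f 1)))
          have h2 := Finset.card_union_le (X'.image (f (-1))) (X'.image (f 0) ∪ X'.image (f 1))
          have h3 := Finset.card_union_le (X'.image (f 0)) (X'.image (f 1))
          have h4 := Finset.card_image_le (s := X') (f := f (-1))
          have h5 := Finset.card_image_le (s := X') (f := f 0)
          have h6 := Finset.card_image_le (s := X') (f := f 1)
          omega
        refine hc.trans ?_
        rw [Finset.card_insert_of_notMem hQ]
        obtain ⟨r, hr⟩ : ∃ r, Module.finrank ℝ V = r + 1 :=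
          ⟨Module.finrank ℝ V - 1, by omega⟩
        rw [hr] at hXc hrank ⊢
        have h7 : X'.card ≤ (3 * Q.card + 1) ^ r :=
          hXc'.trans (Nat.pow_le_pow_right (by omega) (by omega))
        -- Only faces that meet the hyperplane of `h` gain pieces, at most three each, and these
        -- faces are counted in the smaller dimension.
        calc X.card + 3 * X'.card
            ≤ (3 * Q.card + 1) ^ (r + 1) + 3 * (3 * Q.card + 1) ^ r := by omega
          _ = (3 * Q.card + 1) ^ r * (3 * (Q.card + 1) + 1) := by ring
          _ ≤ (3 * (Q.card + 1) + 1) ^ r * (3 * (Q.card + 1) + 1) :=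
              Nat.mul_le_mul_right _ (Nat.pow_le_pow_left (by omega) _)
          _ = _ := by ring
      · intro v hv
        obtain ⟨x, hx, hvx⟩ := hX v hv
        by_cases hs : SignType.sign (inner ℝ h v) = SignType.sign (inner ℝ h x)
        · refine ⟨x, Finset.mem_union_left _ hx, fun q hq => ?_⟩
          rcases Finset.mem_insert.mp (Finset.mem_coe.mp hq) with rfl | hq
          · exact hs
          · exact hvx q hq
        -- The segment from `v` to `x` stays in their common face and crosses the hyperplane of `h`,
        -- so this face has a representative in `X'`.
        · obtain ⟨t, ht0, ht1, ht⟩ := exists_convexComb_eq_zero hs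
          have hw : (1 - t) • v + t • x ∈ V' := by
            rw [hmem]
            refine ⟨V.add_mem (V.smul_mem _ hv) (V.smul_mem _ (hXV x hx)), ?_⟩
            rw [inner_add_right, inner_smul_right, inner_smul_right]; exact ht
          obtain ⟨x', hx', hwx⟩ := hX' _ hw
          have hvx' : AgreeOn (Q : Set (Vec n)) v x' := by
            refine AgreeOn.trans (fun q hq => ?_) hwx
            rw [inner_add_right, inner_smul_right, inner_smul_right]
            exact (sign_convexComb_eq ht0 ht1 (hvx q hq)).symm
          obtain ⟨-, h2⟩ := hf (SignType.sign (inner ℝ h v)) x' ((hmem x').mp (hXV' x' hx')).1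
          obtain ⟨h3, h4⟩ := h2 ⟨v, hv, hvx', rfl⟩
          refine ⟨f (SignType.sign (inner ℝ h v)) x', ?_, fun q hq => ?_⟩
          · simp only [Finset.mem_union, Finset.mem_image]
            cases SignType.sign (inner ℝ h v)
            · exact Or.inr (Or.inr (Or.inl ⟨x', hx', rfl⟩))
            · exact Or.inr (Or.inl ⟨x', hx', rfl⟩)
            · exact Or.inr (Or.inr (Or.inr ⟨x', hx', rfl⟩))
          · rcases Finset.mem_insert.mp (Finset.mem_coe.mp hq) with rfl | hq
            · exact h4.symm
            · exact (hvx'.trans h3.symm) q hq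

end PointLocation

/-! ### Discrete expectations and composition of random decision trees -/

namespace PointLocation

noncomputable section

/-- The expectation of a nonnegative function under a discrete distribution. -/
def expectation {α : Type*} (μ : PMF α) (f : α → ℝ≥0∞) : ℝ≥0∞ := ∑' a, μ a * f a

section expectation

variable {α β : Type*}

theorem expectation_bind (μ : PMF α) (k : α → PMF β) (f : β → ℝ≥0∞) :
    expectation (μ.bind k) f = expectation μ fun a => expectation (k a) f := by
  simp only [expectation, PMF.bind_apply, ← ENNReal.tsum_mul_right, ← ENNReal.tsum_mul_left]
  rw [ENNReal.tsum_comm]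
  simp only [mul_assoc]

theorem expectation_pure (a : α) (f : α → ℝ≥0∞) : expectation (PMF.pure a) f = f a := by
  classical
  unfold expectation
  rw [tsum_eq_single a (fun b hb => by simp [PMF.pure_apply, hb])]
  simp

theorem expectation_map (μ : PMF α) (g : α → β) (f : β → ℝ≥0∞) :
    expectation (μ.map g) f = expectation μ (f ∘ g) := by
  rw [← PMF.bind_pure_comp, expectation_bind]
  simp [expectation_pure, Function.comp_def]

theorem expectation_const (μ : PMF α) (c : ℝ≥0∞) : expectation μ (fun _ => c) = c := by
  rw [expectation, ENNReal.tsum_mul_right, PMF.tsum_coe, one_mul]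

theorem expectation_add (μ : PMF α) (f g : α → ℝ≥0∞) :
    expectation μ (fun a => f a + g a) = expectation μ f + expectation μ g := by
  simp only [expectation, mul_add, ENNReal.tsum_add]

theorem expectation_mono (μ : PMF α) {f g : α → ℝ≥0∞} (h : ∀ a ∈ μ.support, f a ≤ g a) :
    expectation μ f ≤ expectation μ g := by
  refine ENNReal.tsum_le_tsum fun a => ?_
  by_cases ha : μ a = 0
  · simp [ha]
  · exact mul_le_mul_right (h a ((PMF.mem_support_iff μ a).mpr ha)) _

theorem expectation_uniformOfFinset (s : Finset α) (hs : s.Nonempty) (f : α → ℝ≥0∞) :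
    expectation (PMF.uniformOfFinset s hs) f = (s.card : ℝ≥0∞)⁻¹ * ∑ a ∈ s, f a := by
  classical
  rw [expectation, tsum_eq_sum (s := s), Finset.mul_sum]
  · exact Finset.sum_congr rfl fun a ha => by rw [PMF.uniformOfFinset_apply_of_mem hs ha]
  · intro a ha; rw [PMF.uniformOfFinset_apply_of_notMem hs ha, zero_mul]

end expectation

namespace LinearDecisionTree

variable {n : ℕ} {α β : Type} {Q Q' : Set (Vec n)} {x y : Vec n}

theorem QueriesIn.mono {T : LinearDecisionTree n α} (h : T.QueriesIn Q) (hQ : Q ⊆ Q') :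
    T.QueriesIn Q' := by
  induction T with
  | leaf a => trivial
  | node q child ih => exact ⟨hQ h.1, fun s => ih s (h.2 s)⟩

theorem eval_congr {T : LinearDecisionTree n α} (h : T.QueriesIn Q) (hxy : AgreeOn Q x y) :
    T.eval x = T.eval y := by
  induction T with
  | leaf a => rfl
  | node q child ih => simp only [eval]; rw [hxy q h.1]; exact ih _ (h.2 _)

theorem numQueries_congr {T : LinearDecisionTree n α} (h : T.QueriesIn Q) (hxy : AgreeOn Q x y) :
    T.numQueries x = T.numQueries y := by
  induction T with
  | leaf a => rfl
  | node q child ih => simp only [numQueries]; rw [hxy q h.1, ih _ (h.2 _)]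

/-- Continue with the tree `k a` at every leaf with output `a`. -/
def bind : LinearDecisionTree n α → (α → LinearDecisionTree n β) → LinearDecisionTree n β
  | leaf a, k => k a
  | node q child, k => node q fun s => (child s).bind k

theorem eval_bind (T : LinearDecisionTree n α) (k : α → LinearDecisionTree n β) (x : Vec n) :
    (T.bind k).eval x = (k (T.eval x)).eval x := by
  induction T with
  | leaf a => rfl
  | node q child ih => exact ih _

theorem numQueries_bind (T : LinearDecisionTree n α) (k : α → LinearDecisionTree n β)
    (x : Vec n) :
    (T.bind k).numQueries x = T.numQueries x + (k (T.eval x)).numQueries x := by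
  induction T with
  | leaf a => simp [bind, eval, numQueries]
  | node q child ih => simp only [bind, eval, numQueries]; rw [ih]; ring

theorem QueriesIn.bind {T : LinearDecisionTree n α} (h : T.QueriesIn Q)
    {k : α → LinearDecisionTree n β} (hk : ∀ a, (k a).QueriesIn Q) :
    (T.bind k).QueriesIn Q := by
  induction T with
  | leaf a => exact hk a
  | node q child ih => exact ⟨h.1, fun s => ih s (h.2 s)⟩

/-- Apply `f` to the outputs of a tree. -/
def map (f : α → β) (T : LinearDecisionTree n α) : LinearDecisionTree n β :=
  T.bind fun a => leaf (f a)

theorem eval_map (f : α → β) (T : LinearDecisionTree n α) (x : Vec n) :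
    (T.map f).eval x = f (T.eval x) := eval_bind _ _ _

theorem numQueries_map (f : α → β) (T : LinearDecisionTree n α) (x : Vec n) :
    (T.map f).numQueries x = T.numQueries x := numQueries_bind _ _ _

theorem QueriesIn.map {T : LinearDecisionTree n α} (h : T.QueriesIn Q) (f : α → β) :
    (T.map f).QueriesIn Q := h.bind fun _ => trivial

/-- Continue with a random tree drawn from `k a`, independently for each leaf with output `a`. -/
def randomBind (k : α → PMF (LinearDecisionTree n β)) :
    LinearDecisionTree n α → PMF (LinearDecisionTree n β)
  | leaf a => k a
  | node q child =>
      (randomBind k (child (-1))).bind fun T₁ => (randomBind k (child 0)).bind fun T₂ =>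
        (randomBind k (child 1)).bind fun T₃ =>
          -- The constructors of `SignType` are ordered zero, negative, positive.
          PMF.pure (node q fun s => SignType.casesOn s T₂ T₁ T₃)

/-- An input follows one branch only; the trees drawn for the other branches integrate out. -/
theorem expectation_numQueries_randomBind (k : α → PMF (LinearDecisionTree n β))
    (T : LinearDecisionTree n α) (x : Vec n) :
    expectation (T.randomBind k) (fun T' => (T'.numQueries x : ℝ≥0∞)) =
      T.numQueries x + expectation (k (T.eval x)) fun T' => (T'.numQueries x : ℝ≥0∞) := by
  induction T with
  | leaf a => simp [randomBind, eval, numQueries]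
  | node q child ih =>
    simp only [randomBind, expectation_bind, expectation_pure, eval, numQueries]
    push_cast
    rw [add_right_comm, ← ih]
    cases SignType.sign (inner ℝ q x) <;>
      simp only [expectation_add, expectation_const] <;> rfl

theorem queriesIn_of_mem_support_randomBind {k : α → PMF (LinearDecisionTree n β)}
    (hk : ∀ a, ∀ T' ∈ (k a).support, T'.QueriesIn Q) {T : LinearDecisionTree n α}
    (hT : T.QueriesIn Q) : ∀ T' ∈ (T.randomBind k).support, T'.QueriesIn Q := by
  induction T with
  | leaf a => exact hk a
  | node q child ih =>
    intro T' hT'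
    simp only [randomBind, PMF.mem_support_bind_iff, PMF.mem_support_pure_iff] at hT'
    obtain ⟨T₁, h₁, T₂, h₂, T₃, h₃, rfl⟩ := hT'
    refine ⟨hT.1, fun s => ?_⟩
    cases s
    · exact ih _ (hT.2 _) _ h₂
    · exact ih _ (hT.2 _) _ h₁
    · exact ih _ (hT.2 _) _ h₃

theorem exists_eval_eq_of_mem_support_randomBind {k : α → PMF (LinearDecisionTree n β)}
    {T : LinearDecisionTree n α} (x : Vec n) :
    ∀ T' ∈ (T.randomBind k).support,
      ∃ T'' ∈ (k (T.eval x)).support, T'.eval x = T''.eval x := by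
  induction T with
  | leaf a => exact fun T' h => ⟨T', h, rfl⟩
  | node q child ih =>
    intro T' hT'
    simp only [randomBind, PMF.mem_support_bind_iff, PMF.mem_support_pure_iff] at hT'
    obtain ⟨T₁, h₁, T₂, h₂, T₃, h₃, rfl⟩ := hT'
    simp only [eval]
    cases SignType.sign (inner ℝ q x)
    · exact ih _ _ h₂
    · exact ih _ _ h₁
    · exact ih _ _ h₃

end LinearDecisionTree

end

end PointLocation

/-! ### Sorting with few candidates -/

namespace PointLocation

noncomputable section

open LinearDecisionTree

variable {n : ℕ} {Q Q' A A' : Set (Vec n)} {X Y : Finset (Vec n)} {c c' : ℝ}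

/-- Some decision tree with queries in `Q` narrows the candidates in `X` down to points that agree
with the input on `A`. The cost of an input is the number of queries, plus twice the binary
logarithm of the number of candidates that are left; it is at most `c`. -/
def Narrows (Q A : Set (Vec n)) (X : Finset (Vec n)) (c : ℝ) : Prop :=
  ∃ T : LinearDecisionTree n (Finset (Vec n)), T.QueriesIn Q ∧ ∀ x ∈ X,
    x ∈ T.eval x ∧ T.eval x ⊆ X ∧ (∀ y ∈ T.eval x, AgreeOn A x y) ∧
      (T.numQueries x : ℝ) + 2 * Real.logb 2 (T.eval x).card ≤ c

namespace Narrows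

theorem mono (h : Narrows Q A X c) (hQ : Q ⊆ Q')
    (hA : ∀ x y, AgreeOn A x y → AgreeOn A' x y) (hc : c ≤ c') : Narrows Q' A' X c' := by
  obtain ⟨T, hT, h⟩ := h
  exact ⟨T, hT.mono hQ, fun x hx =>
    ⟨(h x hx).1, (h x hx).2.1, fun y hy => hA _ _ ((h x hx).2.2.1 y hy), (h x hx).2.2.2.trans hc⟩⟩

theorem of_agree (h : ∀ x ∈ X, ∀ y ∈ X, AgreeOn A x y) :
    Narrows Q A X (2 * Real.logb 2 X.card) :=
  ⟨leaf X, trivial, fun x hx => ⟨hx, subset_rfl, h x hx, by simp [eval, numQueries]⟩⟩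

theorem query {q : Vec n} (hq : q ∈ Q)
    (h : ∀ s, Narrows Q A (X.filter fun x => SignType.sign (inner ℝ q x) = s) c) :
    Narrows Q A X (c + 1) := by
  choose T hT h using h
  refine ⟨node q T, ⟨hq, hT⟩, fun x hx => ?_⟩
  obtain ⟨h1, h2, h3, h4⟩ := h _ x (Finset.mem_filter.mpr ⟨hx, rfl⟩)
  refine ⟨h1, h2.trans (Finset.filter_subset _ _), h3, ?_⟩
  simp only [eval, numQueries, Nat.cast_add, Nat.cast_one]
  linarith

/-- The term `2 * Real.logb 2 Y.card`, already charged by the first stage, is released as budget for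
the second, so that costs telescope. -/
theorem bind (h : Narrows Q A X c)
    (h' : ∀ Y : Finset (Vec n), Y ⊆ X → (∀ x ∈ Y, ∀ y ∈ Y, AgreeOn A x y) →
      Narrows Q A' Y (c' + 2 * Real.logb 2 Y.card)) :
    Narrows Q (A ∪ A') X (c + c') := by
  classical
  obtain ⟨T, hT, h⟩ := h
  have h'' : ∀ Y : Finset (Vec n), ∃ T' : LinearDecisionTree n (Finset (Vec n)),
      T'.QueriesIn Q ∧ (Y ⊆ X → (∀ x ∈ Y, ∀ y ∈ Y, AgreeOn A x y) → ∀ x ∈ Y,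
        x ∈ T'.eval x ∧ T'.eval x ⊆ Y ∧ (∀ y ∈ T'.eval x, AgreeOn A' x y) ∧
          (T'.numQueries x : ℝ) + 2 * Real.logb 2 (T'.eval x).card ≤
            c' + 2 * Real.logb 2 Y.card) := by
    intro Y
    by_cases hY : Y ⊆ X ∧ ∀ x ∈ Y, ∀ y ∈ Y, AgreeOn A x y
    · obtain ⟨T', hT', h⟩ := h' Y hY.1 hY.2
      exact ⟨T', hT', fun _ _ => h⟩
    · exact ⟨leaf Y, trivial, fun h1 h2 => absurd ⟨h1, h2⟩ hY⟩
  choose k hk hk' using h''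
  refine ⟨T.bind k, hT.bind hk, fun x hx => ?_⟩
  obtain ⟨h1, h2, h3, h4⟩ := h x hx
  obtain ⟨h5, h6, h7, h8⟩ := hk' (T.eval x) h2
    (fun y hy z hz => (h3 y hy).symm.trans (h3 z hz)) x h1
  rw [eval_bind, numQueries_bind]
  refine ⟨h5, h6.trans h2, fun y hy => (h3 y (h6 hy)).union (h7 y hy), ?_⟩
  push_cast
  linarith

end Narrows

theorem two_add_two_mul_logb_le_of_two_mul_le {a b : ℕ} (ha : 0 < a) (h : 2 * a ≤ b) :
    2 + 2 * Real.logb 2 a ≤ 2 * Real.logb 2 b := by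
  have ha' : (0 : ℝ) < a := by exact_mod_cast ha
  have h1 : Real.logb 2 (2 * a : ℝ) ≤ Real.logb 2 b :=
    Real.logb_le_logb_of_le (by norm_num) (by positivity) (by exact_mod_cast h)
  rw [Real.logb_mul (by norm_num) ha'.ne', Real.logb_self_eq_one (by norm_num)] at h1
  linarith

/-- Weighted binary search for the place of `h` among the elements of `B`, when all candidates
order `B` in the same way. -/
theorem narrows_insert (h : Vec n) (B : Finset (Vec n)) (X : Finset (Vec n))
    (hX : ∀ x ∈ X, ∀ y ∈ X, AgreeOn ((B : Set (Vec n)) - (B : Set (Vec n))) x y) :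
    Narrows ({h} - (B : Set (Vec n))) ({h} - (B : Set (Vec n))) X (2 + 2 * Real.logb 2 X.card) := by
  classical
  induction hN : X.card using Nat.strong_induction_on generalizing X with
  | _ N ih =>
  subst hN
  rcases X.eq_empty_or_nonempty with rfl | ⟨x₀, hx₀⟩
  · exact (Narrows.of_agree (by simp)).mono subset_rfl (fun _ _ h => h) (by simp)
  have hpos : 0 < X.card := Finset.card_pos.mpr ⟨x₀, hx₀⟩
  have hmemQ : ∀ b ∈ B, h - b ∈ ({h} : Set (Vec n)) - (B : Set (Vec n)) :=
    fun b hb => Set.sub_mem_sub rfl hb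
  have hlog : ∀ Y : Finset (Vec n), Y ⊆ X →
      2 * Real.logb 2 Y.card ≤ 2 * Real.logb 2 X.card := by
    intro Y hY
    -- For empty `Y` the convention `Real.logb 2 0 = 0` applies.
    rcases Y.eq_empty_or_nonempty with rfl | hYn
    · have : 0 ≤ Real.logb 2 X.card := Real.logb_nonneg (by norm_num) (by exact_mod_cast hpos)
      simpa using this
    · have := Real.logb_le_logb_of_le (b := 2) (by norm_num)
        (by exact_mod_cast hYn.card_pos) (Nat.cast_le (α := ℝ).mpr (Finset.card_le_card hY))
      linarith
  have hhalf : ∀ Y : Finset (Vec n), Y ⊆ X → 2 * Y.card ≤ X.card →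
      Narrows ({h} - (B : Set (Vec n))) ({h} - (B : Set (Vec n))) Y (2 * Real.logb 2 X.card) := by
    intro Y hY hYc
    rcases Y.eq_empty_or_nonempty with rfl | hYn
    · exact (Narrows.of_agree (by simp)).mono subset_rfl (fun _ _ h => h) (hlog _ hY)
    · exact (ih _ (by omega) Y (fun x hx y hy => hX x (hY hx) y (hY hy)) rfl).mono subset_rfl
        (fun _ _ h => h) (two_add_two_mul_logb_le_of_two_mul_le hYn.card_pos hYc)
  have hdone : ∀ Y : Finset (Vec n), Y ⊆ X → ∀ s : Vec n → SignType,
      (∀ y ∈ Y, ∀ b ∈ B, SignType.sign (inner ℝ (h - b) y) = s b) →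
      Narrows ({h} - (B : Set (Vec n))) ({h} - (B : Set (Vec n))) Y (2 * Real.logb 2 X.card) := by
    intro Y hY s hs
    refine (Narrows.of_agree ?_).mono subset_rfl (fun _ _ h => h) (hlog _ hY)
    rintro x hx y hy q hq
    obtain ⟨_, rfl, b, hb, rfl⟩ := Set.mem_sub.mp hq
    rw [hs x hx b hb, hs y hy b hb]
  have hord : ∀ b ∈ B, ∀ b' ∈ B, ∀ y ∈ X, inner ℝ b x₀ ≤ inner ℝ b' x₀ →
      inner ℝ b y ≤ (inner ℝ b' y : ℝ) := by
    intro b hb b' hb' y hy hle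
    have h1 := hX y hy x₀ hx₀ (b' - b) (Set.sub_mem_sub hb' hb)
    rw [inner_sub_left, inner_sub_left] at h1
    by_contra hlt
    rw [sign_neg (sub_neg.mpr (not_le.mp hlt))] at h1
    have := sign_eq_neg_one_iff.mp h1.symm
    linarith
  -- Once `h` ties with `b'`, its place is that of `b'` in the common order.
  have heq : ∀ b' ∈ B, ∀ Y : Finset (Vec n), Y ⊆ X →
      (∀ y ∈ Y, SignType.sign (inner ℝ (h - b') y) = 0) →
      Narrows ({h} - (B : Set (Vec n))) ({h} - (B : Set (Vec n))) Y (2 * Real.logb 2 X.card) := by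
    intro b' hb' Y hY hz
    refine hdone Y hY (fun b => SignType.sign (inner ℝ (b' - b) x₀)) fun y hy b hb => ?_
    rw [← hX y (hY hy) x₀ hx₀ (b' - b) (Set.sub_mem_sub hb' hb)]
    have := sign_eq_zero_iff.mp (hz y hy)
    rw [inner_sub_left] at this ⊢
    rw [inner_sub_left, sub_eq_zero.mp this]
  set lt : Vec n → Finset (Vec n) := fun b =>
    X.filter fun x => SignType.sign (inner ℝ (h - b) x) = -1 with hlt
  -- `L` and `U` split `B` at the weighted median: at most half of the candidates put `h` below a
  -- given element of `L`, more than half below a given element of `U`. Comparisons with the maximum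
  -- of `L` and the minimum of `U` suffice.
  set L := B.filter fun b => 2 * (lt b).card ≤ X.card with hL
  set U := B.filter fun b => ¬ 2 * (lt b).card ≤ X.card with hU
  have hupper : ∀ X₁ : Finset (Vec n), X₁ ⊆ X →
      (∀ x ∈ X₁, ∀ b ∈ L, SignType.sign (inner ℝ (h - b) x) = 1) →
      Narrows ({h} - (B : Set (Vec n))) ({h} - (B : Set (Vec n))) X₁
        (2 * Real.logb 2 X.card + 1) := by
    intro X₁ hX₁ h1
    rcases U.eq_empty_or_nonempty with hUe | hUn
    · refine (hdone X₁ hX₁ (fun _ => 1) fun y hy b hb => h1 y hy b ?_).mono subset_rfl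
        (fun _ _ h => h) (by linarith)
      by_contra hbL
      have : b ∈ U := by
        rw [hU, Finset.mem_filter]
        exact ⟨hb, fun h2 => hbL (Finset.mem_filter.mpr ⟨hb, h2⟩)⟩
      simp [hUe] at this
    · obtain ⟨b', hb', hmin⟩ := Finset.exists_min_image U (fun b => (inner ℝ b x₀ : ℝ)) hUn
      have hb'B : b' ∈ B := (Finset.mem_filter.mp hb').1
      refine Narrows.query (hmemQ b' hb'B) fun s => ?_
      have hsub : (X₁.filter fun x => SignType.sign (inner ℝ (h - b') x) = s) ⊆ X :=
        (Finset.filter_subset _ _).trans hX₁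
      cases s
      · exact heq b' hb'B _ hsub fun y hy => (Finset.mem_filter.mp hy).2
      -- Now `h` lies above all of `L` and below all of `U`, so its place is known.
      · refine hdone _ hsub (fun b => if b ∈ L then 1 else -1) fun y hy b hb => ?_
        obtain ⟨hy1, hy2⟩ := Finset.mem_filter.mp hy
        by_cases hbL : b ∈ L
        · simp only [hbL, if_true]; exact h1 y hy1 b hbL
        · simp only [hbL, if_false]
          have hbU : b ∈ U := by
            rw [hU, Finset.mem_filter]
            exact ⟨hb, fun h2 => hbL (Finset.mem_filter.mpr ⟨hb, h2⟩)⟩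
          have h3 := hord b' hb'B b hb y (hX₁ hy1) (hmin b hbU)
          have h4 : inner ℝ (h - b') y < (0 : ℝ) := sign_eq_neg_one_iff.mp hy2
          apply sign_neg
          rw [inner_sub_left] at h4 ⊢
          linarith
      -- The candidates in `lt b'`, more than half of all, are excluded.
      · refine hhalf _ hsub ?_
        have hdisj : Disjoint (X₁.filter fun x => SignType.sign (inner ℝ (h - b') x) = .pos)
            (lt b') := by
          rw [Finset.disjoint_left]
          intro y hy hy'
          have := (Finset.mem_filter.mp hy).2.symm.trans (Finset.mem_filter.mp hy').2
          exact absurd this (by decide)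
        have h5 := Finset.card_le_card
          (Finset.union_subset hsub (Finset.filter_subset _ _ : lt b' ⊆ X))
        rw [Finset.card_union_of_disjoint hdisj] at h5
        have h6 := (Finset.mem_filter.mp hb').2
        omega
  rcases L.eq_empty_or_nonempty with hLe | hLn
  · exact (hupper X subset_rfl (by simp [hLe])).mono subset_rfl (fun _ _ h => h) (by linarith)
  · obtain ⟨b', hb', hmax⟩ := Finset.exists_max_image L (fun b => (inner ℝ b x₀ : ℝ)) hLn
    have hb'B : b' ∈ B := (Finset.mem_filter.mp hb').1
    refine (Narrows.query (c := 2 * Real.logb 2 X.card + 1) (hmemQ b' hb'B) fun s => ?_).mono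
      subset_rfl (fun _ _ h => h) (by linarith)
    have hsub : (X.filter fun x => SignType.sign (inner ℝ (h - b') x) = s) ⊆ X :=
      Finset.filter_subset _ _
    cases s
    · exact (heq b' hb'B _ hsub fun y hy => (Finset.mem_filter.mp hy).2).mono subset_rfl
        (fun _ _ h => h) (by linarith)
    · exact (hhalf _ hsub (Finset.mem_filter.mp hb').2).mono subset_rfl
        (fun _ _ h => h) (by linarith)
    · refine hupper _ hsub fun y hy b hb => ?_
      obtain ⟨hy1, hy2⟩ := Finset.mem_filter.mp hy
      have h3 := hord b (Finset.mem_filter.mp hb).1 b' hb'B y hy1 (hmax b hb)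
      have h4 : (0 : ℝ) < inner ℝ (h - b') y := sign_eq_one_iff.mp hy2
      apply sign_pos
      rw [inner_sub_left] at h4 ⊢
      linarith

theorem AgreeOn.of_neg_mem {x y : Vec n} (h : AgreeOn A x y)
    (hA : ∀ q ∈ A', q ∈ A ∨ -q ∈ A ∨ q = 0) : AgreeOn A' x y := by
  intro q hq
  rcases hA q hq with hq | hq | rfl
  · exact h q hq
  · have := h _ hq
    rw [inner_neg_left, inner_neg_left, Left.sign_neg, Left.sign_neg] at this
    exact neg_injective this
  · simp

/-- Insertion sort, with the weighted binary search. -/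
theorem narrows_sort (S : Finset (Vec n)) (X : Finset (Vec n)) :
    Narrows ((S : Set (Vec n)) ∪ (S - S)) ((S : Set (Vec n)) ∪ (S - S)) X
      (2 * S.card + 2 * Real.logb 2 X.card) := by
  classical
  induction S using Finset.induction_on with
  | empty =>
    refine (Narrows.of_agree ?_).mono subset_rfl (fun _ _ h => h) (by simp)
    intro x _ y _ q hq
    simp at hq
  | insert h S hS ih =>
    have hsubset : ((S : Set (Vec n)) ∪ (S - S)) ⊆
        ((insert h S : Finset (Vec n)) : Set (Vec n)) ∪
          (((insert h S : Finset (Vec n)) : Set (Vec n)) - (insert h S : Finset (Vec n))) := by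
      have : (S : Set (Vec n)) ⊆ (insert h S : Finset (Vec n)) := by simp
      exact Set.union_subset_union this (Set.sub_subset_sub this this)
    -- With `0` among the elements to compare with, label queries become comparisons, and one search
    -- finds the sign of `h` too.
    have key := Narrows.bind (c' := 2) (ih.mono hsubset (fun _ _ h => h) le_rfl)
      (A' := {h} - ((insert 0 S : Finset (Vec n)) : Set (Vec n))) fun Y _ hY =>
        (narrows_insert h (insert 0 S) Y fun x hx y hy => (hY x hx y hy).of_neg_mem ?_).mono
          ?_ (fun _ _ h => h) le_rfl
    · refine key.mono subset_rfl (fun x y hxy => hxy.of_neg_mem ?_) ?_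
      · rintro q (hq | hq)
        · rcases Finset.mem_insert.mp (Finset.mem_coe.mp hq) with rfl | hq
          · exact Or.inl (Or.inr (Set.mem_sub.mpr ⟨q, rfl, 0, by simp, by simp⟩))
          · exact Or.inl (Or.inl (Or.inl hq))
        · obtain ⟨a, ha, b, hb, rfl⟩ := Set.mem_sub.mp hq
          rcases Finset.mem_insert.mp (Finset.mem_coe.mp ha) with rfl | ha <;>
            rcases Finset.mem_insert.mp (Finset.mem_coe.mp hb) with rfl | hb
          · simp
          · exact Or.inl (Or.inr (Set.mem_sub.mpr ⟨a, rfl, b, by simp [hb], rfl⟩))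
          · exact Or.inr (Or.inl (Or.inr (Set.mem_sub.mpr ⟨b, rfl, a, by simp [‹a ∈ S›], by simp⟩)))
          · exact Or.inl (Or.inl (Or.inr (Set.sub_mem_sub ha hb)))
      · rw [Finset.card_insert_of_notMem hS]; push_cast; linarith
    · intro q hq
      obtain ⟨a, ha, b, hb, rfl⟩ := Set.mem_sub.mp hq
      rcases Finset.mem_insert.mp (Finset.mem_coe.mp ha) with rfl | ha <;>
        rcases Finset.mem_insert.mp (Finset.mem_coe.mp hb) with rfl | hb
      · simp
      · exact Or.inr (Or.inl (Or.inl (by simpa using hb)))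
      · exact Or.inl (Or.inl (by simpa using ha))
      · exact Or.inl (Or.inr (Set.sub_mem_sub ha hb))
    · intro q hq
      obtain ⟨_, rfl, b, hb, rfl⟩ := Set.mem_sub.mp hq
      rcases Finset.mem_insert.mp (Finset.mem_coe.mp hb) with rfl | hb
      · exact Or.inl (by simp)
      · exact Or.inr (Set.sub_mem_sub (by simp) (by simp [hb]))

theorem mem_cell_iff {S : Set (Vec n)} {x y : Vec n} :
    y ∈ cell S x ↔ AgreeOn (S ∪ (S - S)) y x := by
  constructor
  · intro h q hq
    have := congrFun h ⟨q, hq⟩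
    simpa only [signPattern, real_inner_comm] using this
  · intro h
    funext q
    simpa only [signPattern, real_inner_comm] using h q q.2

/-- A finite set `S` is sorted by a comparison tree of depth linear in `|S|` and in the logarithm
of the number of cells. -/
theorem exists_sorting_tree (S : Finset (Vec n)) :
    ∃ T : LinearDecisionTree n (Vec n), T.IsComparison (S : Set (Vec n)) ∧ ∀ x : Vec n,
      T.eval x ∈ cell (S : Set (Vec n)) x ∧ (T.numQueries x : ℝ) ≤
        2 * S.card + 2 * (n * Real.logb 2 (3 * (S.card + S.card ^ 2) + 1)) := by
  classical
  obtain ⟨X, -, hXc, hX⟩ := exists_representatives (S ∪ (S - S)) ⊤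
  obtain ⟨T, hT, h⟩ := narrows_sort S X
  -- Any remaining candidate lies in the cell of the input; the default `0` is never output, since
  -- the representative of the input always survives.
  refine ⟨T.map fun Y => if hY : Y.Nonempty then hY.choose else 0, hT.map _, fun x => ?_⟩
  obtain ⟨x', hx', hxx'⟩ := hX x trivial
  have hxx'' : AgreeOn ((S : Set (Vec n)) ∪ (S - S)) x x' := by simpa using hxx'
  obtain ⟨h1, h2, h3, h4⟩ := h x' hx'
  rw [eval_map, numQueries_map, eval_congr hT hxx'', numQueries_congr hT hxx'']
  have hne : (T.eval x').Nonempty := ⟨x', h1⟩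
  constructor
  · rw [dif_pos hne, mem_cell_iff]
    exact (hxx''.trans (h3 _ hne.choose_spec)).symm
  · have h5 : 0 ≤ Real.logb 2 (T.eval x').card :=
      Real.logb_nonneg (by norm_num) (by exact_mod_cast hne.card_pos)
    have h6 : X.card ≤ (3 * (S.card + S.card ^ 2) + 1) ^ n := by
      refine hXc.trans ?_
      rw [finrank_top, finrank_euclideanSpace_fin]
      refine Nat.pow_le_pow_left ?_ _
      have h7 := Finset.card_union_le S (S - S)
      have h8 := Finset.card_sub_le (s := S) (t := S)
      nlinarith
    have h9 : Real.logb 2 X.card ≤ n * Real.logb 2 (3 * (S.card + S.card ^ 2) + 1) := by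
      rw [← Real.logb_pow]
      exact Real.logb_le_logb_of_le (by norm_num)
        (by exact_mod_cast Finset.card_pos.mpr ⟨x', hx'⟩) (by exact_mod_cast h6)
    linarith

end

end PointLocation

/-! ### Inference from random samples -/

namespace PointLocation

noncomputable section

open LinearDecisionTree

variable {n : ℕ} {H S S' : Set (Vec n)} {h x y : Vec n} {d : ℕ}

theorem mem_cell_symm (hxy : y ∈ cell S x) : x ∈ cell S y := by
  rw [mem_cell_iff] at hxy ⊢
  exact hxy.symm

theorem infers_of_mem (hh : h ∈ S) : Infers S h x := by
  intro x' hx'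
  simpa only [real_inner_comm] using mem_cell_iff.mp hx' h (Or.inl hh)

theorem Infers.mono (hS : Infers S h x) (hSS' : S ⊆ S') : Infers S' h x := fun x' hx' =>
  hS x' <| mem_cell_iff.mpr <| (mem_cell_iff.mp hx').mono <|
    Set.union_subset_union hSS' (Set.sub_subset_sub hSS' hSS')

theorem Infers.of_mem_cell (hS : Infers S h x) (hxy : y ∈ cell S x) : Infers S h y := by
  intro z hz
  rw [hS y hxy]
  exact hS z (mem_cell_iff.mpr ((mem_cell_iff.mp hz).trans (mem_cell_iff.mp hxy)))

/-- If `d` elements failed, the inference dimension would make one of them inferred by the other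
failing ones, hence by the larger set `U \ {h}`. -/
theorem card_filter_not_infers_lt (hd : IsInferenceDimension H d) (U : Finset (Vec n))
    (hU : (U : Set (Vec n)) ⊆ H) (x : Vec n) [DecidablePred fun h => ¬ Infers (↑U \ {h}) h x] :
    (U.filter fun h => ¬ Infers (↑U \ {h}) h x).card < d := by
  by_contra hlt
  rw [not_lt] at hlt
  obtain ⟨h, hh, hinf⟩ := hd.1.2 (U.filter fun h => ¬ Infers (↑U \ {h}) h x : Finset (Vec n))
    ((Finset.coe_subset.mpr (Finset.filter_subset _ _)).trans hU)
    (by rw [Set.encard_coe_eq_coe_finsetCard]; exact_mod_cast hlt) x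
  exact (Finset.mem_filter.mp (Finset.mem_coe.mp hh)).2
    (hinf.mono (Set.sdiff_subset_sdiff_left (Finset.coe_subset.mpr (Finset.filter_subset _ _))))

/-- If `d = 1`, then the empty set infers every `h ∈ H` at `0`. Its cell is the whole space, so
testing at `h` itself gives `⟪h, h⟫ = 0`, and `H` has at most one element. -/
theorem IsInferenceDimension.two_le {H : Finset (Vec n)}
    (hd : IsInferenceDimension (H : Set (Vec n)) d) (hH : 2 ≤ H.card) : 2 ≤ d := by
  by_contra hlt
  have h1 : d = 1 := by have := hd.1.1; omega
  subst h1
  have hzero : ∀ h ∈ H, h = 0 := by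
    intro h hh
    obtain ⟨h', hh', hinf⟩ := hd.1.2 {h} (by simpa using hh) (by simp) 0
    rw [Set.mem_singleton_iff] at hh'
    subst hh'
    have h2 := hinf h' (mem_cell_iff.mpr fun q hq => by simp at hq)
    rw [inner_zero_left, sign_zero, sign_eq_zero_iff] at h2
    exact inner_self_eq_zero.mp h2
  obtain ⟨a, ha, b, hb, hab⟩ := Finset.one_lt_card.mp (show 1 < H.card by omega)
  exact hab ((hzero a ha).trans (hzero b hb).symm)

open Classical in
/-- The elements of `G` whose sign at `x` is not inferred by `S`. -/
def notInferred (G S : Finset (Vec n)) (x : Vec n) : Finset (Vec n) :=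
  G.filter fun h => ¬ Infers (S : Set (Vec n)) h x

theorem mem_notInferred {G S : Finset (Vec n)} :
    h ∈ notInferred G S x ↔ h ∈ G ∧ ¬ Infers (S : Set (Vec n)) h x := by
  simp [notInferred]

/-- The rest is determined by the cell, so any point of the cell, such as the output of the sorting
tree, can replace the input. -/
theorem notInferred_congr (G S : Finset (Vec n)) (hxy : y ∈ cell (S : Set (Vec n)) x) :
    notInferred G S y = notInferred G S x := by
  ext h
  rw [mem_notInferred, mem_notInferred]
  exact and_congr_right fun _ => not_congr
    ⟨fun hy => hy.of_mem_cell (mem_cell_symm hxy), fun hx => hx.of_mem_cell hxy⟩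

theorem notInferred_ssubset {G S : Finset (Vec n)} (hS : S.Nonempty) (hSG : S ⊆ G) :
    notInferred G S x ⊂ G := by
  obtain ⟨s, hs⟩ := hS
  refine (Finset.ssubset_iff_of_subset fun h hh => (mem_notInferred.mp hh).1).mpr
    ⟨s, hSG hs, fun h => (mem_notInferred.mp h).2 (infers_of_mem hs)⟩

/-- Double counting of the pairs `(S, h)` for which `S` does not infer `h` at `x`. -/
theorem sum_card_notInferred_le (hd : IsInferenceDimension H d) (G : Finset (Vec n))
    (hG : (G : Set (Vec n)) ⊆ H) (m : ℕ) (x : Vec n) :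
    ∑ S ∈ G.powersetCard m, (notInferred G S x).card ≤ G.card.choose (m + 1) * d := by
  classical
  have h1 : ∑ U ∈ G.powersetCard (m + 1), (U.filter fun h => ¬ Infers (↑U \ {h}) h x).card ≤
      G.card.choose (m + 1) * d := by
    rw [← Finset.card_powersetCard, ← smul_eq_mul]
    refine Finset.sum_le_card_nsmul _ _ _ fun U hU => (card_filter_not_infers_lt hd U ?_ x).le
    exact (Finset.coe_subset.mpr (Finset.mem_powersetCard.mp hU).1).trans hG
  refine le_trans ?_ h1
  rw [← Finset.card_sigma, ← Finset.card_sigma]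
  have hnot : ∀ S : Finset (Vec n), ∀ h ∈ notInferred G S x, h ∉ S := fun S h hh hS =>
    (mem_notInferred.mp hh).2 (infers_of_mem hS)
  -- Since `S` infers its own members, `h ∉ S`; erasing `h` from the enlarged set recovers `S`.
  refine Finset.card_le_card_of_injOn (fun p => ⟨insert p.2 p.1, p.2⟩) ?_ ?_
  · rintro ⟨S, h⟩ hp
    obtain ⟨hS, hh⟩ := Finset.mem_sigma.mp (Finset.mem_coe.mp hp)
    dsimp only at hS hh
    have hhS := hnot S h hh
    obtain ⟨hSG, hSc⟩ := Finset.mem_powersetCard.mp hS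
    obtain ⟨hhG, hinf⟩ := mem_notInferred.mp hh
    refine Finset.mem_coe.mpr (Finset.mem_sigma.mpr ⟨Finset.mem_powersetCard.mpr ⟨?_, ?_⟩,
      Finset.mem_filter.mpr ⟨Finset.mem_insert_self _ _, ?_⟩⟩)
    · exact Finset.insert_subset hhG hSG
    · rw [Finset.card_insert_of_notMem hhS, hSc]
    · dsimp only
      rwa [← Finset.coe_erase, Finset.erase_insert hhS]
  · rintro ⟨S, h⟩ hp ⟨S', h'⟩ hp' heq
    have hhS := hnot S h (Finset.mem_sigma.mp (Finset.mem_coe.mp hp)).2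
    have hhS' := hnot S' h' (Finset.mem_sigma.mp (Finset.mem_coe.mp hp')).2
    simp only [Sigma.mk.injEq, heq_eq_eq] at heq
    obtain ⟨h2, rfl⟩ := heq
    have : S = S' := by
      rw [← Finset.erase_insert hhS, ← Finset.erase_insert hhS', h2]
    rw [this]

/-- A random sample of `2 d` elements infers at least half of the elements in expectation. -/
theorem two_mul_sum_card_notInferred_le (hd : IsInferenceDimension H d) (G : Finset (Vec n))
    (hG : (G : Set (Vec n)) ⊆ H) (x : Vec n) :
    2 * ∑ S ∈ G.powersetCard (min (2 * d) G.card), (notInferred G S x).card ≤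
      (G.powersetCard (min (2 * d) G.card)).card * G.card := by
  -- A set `G` of at most `2 d` elements is its own sample and leaves nothing.
  rcases le_total G.card (2 * d) with hle | hle
  · rw [min_eq_right hle, Finset.powersetCard_self, Finset.sum_singleton]
    have : notInferred G G x = ∅ := by
      refine Finset.eq_empty_of_forall_notMem fun h hh => ?_
      obtain ⟨h1, h2⟩ := mem_notInferred.mp hh
      exact h2 (infers_of_mem h1)
    simp [this]
  · rw [min_eq_left hle, Finset.card_powersetCard]
    have h1 := sum_card_notInferred_le hd G hG (2 * d) x
    have h2 := Nat.choose_succ_right_eq G.card (2 * d)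
    set s := ∑ S ∈ G.powersetCard (2 * d), (notInferred G S x).card
    have h3 : (2 * d + 1) * (2 * s) ≤ (2 * d + 1) * (G.card.choose (2 * d) * G.card) := by
      calc (2 * d + 1) * (2 * s) ≤ (2 * d + 1) * (2 * (G.card.choose (2 * d + 1) * d)) := by gcongr
        _ = (G.card.choose (2 * d + 1) * (2 * d + 1)) * (2 * d) := by ring
        _ = (G.card.choose (2 * d) * (G.card - 2 * d)) * (2 * d) := by rw [h2]
        _ ≤ (G.card.choose (2 * d) * G.card) * (2 * d + 1) := by
          gcongr <;> omega
        _ = _ := by ring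
    exact Nat.le_of_mul_le_mul_left h3 (by omega)

/-- If the average of `f` is at most `N / 2`, then the average of `log (1 + f)` is at most
`log (1 + N) - 1 / 4`. -/
theorem inv_card_mul_sum_log_le {ι : Type*} (P : Finset ι) (hP : P.Nonempty) (f : ι → ℕ) (N : ℕ)
    (hN : 1 ≤ N) (hf : 2 * ∑ i ∈ P, f i ≤ P.card * N) :
    (P.card : ℝ)⁻¹ * ∑ i ∈ P, Real.log (1 + f i) ≤ Real.log (1 + N) - 1 / 4 := by
  have hN' : (1 : ℝ) ≤ N := by exact_mod_cast hN
  have hP' : (0 : ℝ) < P.card := by exact_mod_cast hP.card_pos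
  have hc : (0 : ℝ) < 1 + N / 2 := by linarith
  -- Jensen's inequality by hand: the tangent of `log` at `1 + N / 2`.
  have htan : ∀ i ∈ P, Real.log (1 + f i) ≤
      (Real.log (1 + N / 2) - 1) + (1 + f i) * (1 + (N : ℝ) / 2)⁻¹ := by
    intro i _
    have h0 : (0 : ℝ) < 1 + f i := by positivity
    have := Real.log_le_sub_one_of_pos (div_pos h0 hc)
    rw [Real.log_div h0.ne' hc.ne', div_eq_mul_inv (1 + (f i : ℝ))] at this
    linarith
  have hsum : ∑ i ∈ P, (1 + (f i : ℝ)) ≤ P.card * (1 + N / 2) := by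
    rw [Finset.sum_add_distrib, Finset.sum_const, nsmul_eq_mul]
    have : (2 : ℝ) * ∑ i ∈ P, (f i : ℝ) ≤ P.card * N := by exact_mod_cast hf
    linarith
  have h1 : ∑ i ∈ P, Real.log (1 + f i) ≤ P.card * Real.log (1 + N / 2) := by
    refine (Finset.sum_le_sum htan).trans ?_
    rw [Finset.sum_add_distrib, Finset.sum_const, nsmul_eq_mul, ← Finset.sum_mul]
    have h2 := mul_le_mul_of_nonneg_right hsum (inv_nonneg.mpr hc.le)
    rw [mul_assoc, mul_inv_cancel₀ hc.ne', mul_one] at h2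
    linarith
  have h2 : Real.log (1 + N / 2) ≤ Real.log (1 + N) - 1 / 4 := by
    have h3 := Real.one_sub_inv_le_log_of_pos (div_pos (by linarith : (0 : ℝ) < 1 + N) hc)
    rw [Real.log_div (by linarith) hc.ne', inv_div] at h3
    -- This is where `1 ≤ N` enters, with equality at `N = 1`.
    have h4 : (1 + (N : ℝ) / 2) / (1 + N) ≤ 3 / 4 := by
      rw [div_le_iff₀ (by linarith)]; linarith
    linarith
  rw [inv_mul_le_iff₀ hP']
  exact h1.trans (mul_le_mul_of_nonneg_left h2 hP'.le)

/-- If sorting at most `2 d` elements costs at most `K`, then repeated sampling determines all signs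
in `G` with an expected number of `4 K log (1 + |G|)` queries. -/
theorem exists_random_tree (hd : IsInferenceDimension H d) {K : ℝ} (hK : 0 ≤ K)
    (hsort : ∀ S : Finset (Vec n), S.card ≤ 2 * d → ∃ T : LinearDecisionTree n (Vec n),
      T.IsComparison (S : Set (Vec n)) ∧ ∀ x : Vec n,
        T.eval x ∈ cell (S : Set (Vec n)) x ∧ (T.numQueries x : ℝ) ≤ K)
    (G : Finset (Vec n)) (hG : (G : Set (Vec n)) ⊆ H) :
    ∃ μ : PMF (LinearDecisionTree n (Vec n → SignType)),
      (∀ T ∈ μ.support, T.IsComparison H ∧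
        ∀ x, ∀ h ∈ G, T.eval x h = SignType.sign (inner ℝ x h)) ∧
      ∀ x, expectation μ (fun T => (T.numQueries x : ℝ≥0∞)) ≤
        ENNReal.ofReal (4 * K * Real.log (1 + G.card)) := by
  classical
  induction G using Finset.strongInduction with
  | H G ih =>
  rcases G.eq_empty_or_nonempty with rfl | hGn
  · refine ⟨PMF.pure (leaf 0), fun T hT => ?_, fun x => ?_⟩
    · rw [PMF.mem_support_pure_iff] at hT
      subst hT
      exact ⟨trivial, by simp⟩
    · simp [expectation_pure, numQueries]
  have hdpos : 1 ≤ d := hd.1.1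
  have hNpos : 1 ≤ G.card := hGn.card_pos
  -- The recursive distribution is made total in `R`, with a dummy value off the proper subsets of
  -- `G`.
  have hex : ∀ R : Finset (Vec n), ∃ μ : PMF (LinearDecisionTree n (Vec n → SignType)), R ⊂ G →
      (∀ T ∈ μ.support, T.IsComparison H ∧
        ∀ x, ∀ h ∈ R, T.eval x h = SignType.sign (inner ℝ x h)) ∧
      ∀ x, expectation μ (fun T => (T.numQueries x : ℝ≥0∞)) ≤
        ENNReal.ofReal (4 * K * Real.log (1 + R.card)) := by
    intro R
    by_cases hR : R ⊂ G
    · obtain ⟨μ, hμ⟩ := ih R hR ((Finset.coe_subset.mpr hR.1).trans hG)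
      exact ⟨μ, fun _ => hμ⟩
    · exact ⟨PMF.pure (leaf 0), fun h => absurd h hR⟩
  choose μ hμ using hex
  have hsort' : ∀ S : Finset (Vec n), ∃ T : LinearDecisionTree n (Vec n), S.card ≤ 2 * d →
      T.IsComparison (S : Set (Vec n)) ∧ ∀ x : Vec n,
        T.eval x ∈ cell (S : Set (Vec n)) x ∧ (T.numQueries x : ℝ) ≤ K := by
    intro S
    by_cases hS : S.card ≤ 2 * d
    · obtain ⟨T, hT⟩ := hsort S hS
      exact ⟨T, fun _ => hT⟩
    · exact ⟨leaf 0, fun h => absurd h hS⟩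
  choose T hT using hsort'
  set P := G.powersetCard (min (2 * d) G.card) with hPdef
  have hP : P.Nonempty := Finset.powersetCard_nonempty.mpr (min_le_right _ _)
  have hPmem : ∀ S ∈ P, S ⊆ G ∧ S.Nonempty ∧ S.card ≤ 2 * d := by
    intro S hS
    obtain ⟨h1, h2⟩ := Finset.mem_powersetCard.mp hS
    refine ⟨h1, Finset.card_pos.mp ?_, ?_⟩ <;> rw [h2]
    · exact lt_min (by omega) hNpos
    · exact min_le_left _ _
  -- Here `y` is the output of the sorting tree: inferred signs are read off at `y`, the others come
  -- from the recursive tree.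
  let k : Finset (Vec n) → Vec n → PMF (LinearDecisionTree n (Vec n → SignType)) := fun S y =>
    (μ (notInferred G S y)).map (LinearDecisionTree.map fun g h =>
      if Infers (S : Set (Vec n)) h y then SignType.sign (inner ℝ y h) else g h)
  refine ⟨(PMF.uniformOfFinset P hP).bind fun S => (T S).randomBind (k S), ?_, fun x => ?_⟩
  · intro T' hT'
    obtain ⟨S, hS, hT'⟩ := (PMF.mem_support_bind_iff _ _ _).mp hT'
    rw [PMF.mem_support_uniformOfFinset_iff] at hS
    obtain ⟨hSG, hSn, hSc⟩ := hPmem S hS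
    obtain ⟨hTS, hTS'⟩ := hT S hSc
    constructor
    · refine queriesIn_of_mem_support_randomBind (fun y T'' hT'' => ?_) (hTS.mono ?_) T' hT'
      · obtain ⟨T₀, hT₀, rfl⟩ := (PMF.mem_support_map_iff _ _ _).mp hT''
        exact (((hμ _ (notInferred_ssubset hSn hSG)).1 T₀ hT₀).1).map _
      · have hSH := (Finset.coe_subset.mpr hSG).trans hG
        exact Set.union_subset_union hSH (Set.sub_subset_sub hSH hSH)
    · intro x h hh
      obtain ⟨T'', hT'', heval⟩ := exists_eval_eq_of_mem_support_randomBind x T' hT'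
      obtain ⟨T₀, hT₀, rfl⟩ := (PMF.mem_support_map_iff _ _ _).mp hT''
      rw [heval, eval_map]
      by_cases hinf : Infers (S : Set (Vec n)) h ((T S).eval x)
      · rw [if_pos hinf]
        exact (hinf x (mem_cell_symm (hTS' x).1)).symm
      · rw [if_neg hinf]
        exact ((hμ _ (notInferred_ssubset hSn hSG)).1 T₀ hT₀).2 x h
          (mem_notInferred.mpr ⟨hh, hinf⟩)
  · rw [expectation_bind]
    have hlog : ∀ r : ℕ, 0 ≤ Real.log (1 + r) := fun r =>
      Real.log_nonneg (by linarith [(Nat.cast_nonneg r : (0 : ℝ) ≤ r)])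
    have hround : ∀ S ∈ (PMF.uniformOfFinset P hP).support,
        expectation ((T S).randomBind (k S)) (fun T' => (T'.numQueries x : ℝ≥0∞)) ≤
          ENNReal.ofReal (K + 4 * K * Real.log (1 + (notInferred G S x).card)) := by
      intro S hS
      rw [PMF.mem_support_uniformOfFinset_iff] at hS
      obtain ⟨hSG, hSn, hSc⟩ := hPmem S hS
      obtain ⟨hcell, hcost⟩ := (hT S hSc).2 x
      rw [expectation_numQueries_randomBind, expectation_map,
        ENNReal.ofReal_add hK (mul_nonneg (by linarith) (hlog _))]
      refine add_le_add ?_ ?_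
      · rw [← ENNReal.ofReal_natCast]
        exact ENNReal.ofReal_le_ofReal hcost
      · simp only [Function.comp_def, numQueries_map]
        rw [notInferred_congr G S hcell]
        exact (hμ _ (notInferred_ssubset hSn hSG)).2 x
    refine (expectation_mono _ hround).trans ?_
    have hPpos : (0 : ℝ) < P.card := by exact_mod_cast hP.card_pos
    rw [expectation_uniformOfFinset, ← ENNReal.ofReal_sum_of_nonneg fun S _ =>
      add_nonneg hK (mul_nonneg (by linarith) (hlog _)), ← ENNReal.ofReal_natCast,
      ← ENNReal.ofReal_inv_of_pos hPpos, ← ENNReal.ofReal_mul (inv_nonneg.mpr hPpos.le)]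
    refine ENNReal.ofReal_le_ofReal ?_
    -- The average drop `1 / 4`, multiplied by `4 K`, cancels the cost `K` of this round.
    have havg := inv_card_mul_sum_log_le P hP (fun S => (notInferred G S x).card) G.card hNpos
      (two_mul_sum_card_notInferred_le hd G hG x)
    rw [Finset.sum_add_distrib, Finset.sum_const, nsmul_eq_mul, ← Finset.mul_sum, mul_add,
      inv_mul_cancel_left₀ hPpos.ne', mul_left_comm]
    have := mul_le_mul_of_nonneg_left havg (by linarith : 0 ≤ 4 * K)
    linarith

theorem sorting_cost_le {m d n : ℕ} (hd : 2 ≤ d) (hm : m ≤ 2 * d) :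
    (2 * m + 2 * (n * Real.logb 2 (3 * (m + (m : ℝ) ^ 2) + 1)) : ℝ) ≤
      28 * (d + n * Real.log d) := by
  have hd' : (2 : ℝ) ≤ d := by exact_mod_cast hd
  have hm' : (m : ℝ) ≤ 2 * d := by exact_mod_cast hm
  have hlog2 : (1 : ℝ) / 2 ≤ Real.log 2 := by linarith [Real.log_two_gt_d9]
  have hlogd : 0 ≤ Real.log d := Real.log_nonneg (by linarith)
  -- The left side is at most `32 d ^ 2`, and `32 ≤ d ^ 5` because `2 ≤ d`. The exponent `7` becomes
  -- `14` below through `1 / 2 ≤ log 2`.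
  have h1 : 3 * (m + (m : ℝ) ^ 2) + 1 ≤ (d : ℝ) ^ 7 := by
    have h2 : (m : ℝ) ^ 2 ≤ (2 * d) ^ 2 := by gcongr
    have h3 : (2 : ℝ) ^ 5 ≤ (d : ℝ) ^ 5 := by gcongr
    have h4 : (d : ℝ) ^ 2 * 2 ^ 5 ≤ (d : ℝ) ^ 2 * (d : ℝ) ^ 5 := by gcongr
    nlinarith
  have h2 : Real.logb 2 (3 * (m + (m : ℝ) ^ 2) + 1) ≤ 14 * Real.log d := by
    rw [Real.logb, div_le_iff₀ (by linarith)]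
    have h3 := Real.log_le_log (by positivity) h1
    rw [Real.log_pow] at h3
    push_cast at h3
    nlinarith
  have h3 := mul_le_mul_of_nonneg_left h2 (Nat.cast_nonneg n : (0 : ℝ) ≤ n)
  linarith

end

end PointLocation

/-! ### The main theorem -/

open PointLocation LinearDecisionTree in
theorem mainTheorem4 :
    ∃ C : ℝ, 0 < C ∧
      ∀ (n : ℕ) (H : Finset (PointLocation.Vec n)) (d : ℕ),
        2 ≤ H.card →
        PointLocation.IsInferenceDimension (H : Set (PointLocation.Vec n)) d →
        ∃ R : PointLocation.ZeroErrorComparisonTree (H : Set (PointLocation.Vec n)),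
          R.expectedQueryComplexity ≤
            ENNReal.ofReal (C * (((d : ℝ) + (n : ℝ) * Real.log d) * Real.log H.card)) := by
  -- `224 = 28 * 4 * 2`: the sorting cost, the potential, and `log (1 + |H|) ≤ 2 log |H|`.
  refine ⟨224, by norm_num, fun n H d hH hd => ?_⟩
  have hd2 := hd.two_le hH
  have hlogd : 0 ≤ Real.log d := Real.log_nonneg (by exact_mod_cast hd.1.1)
  set K : ℝ := 28 * (d + n * Real.log d) with hKdef
  have hK : 0 ≤ K := by positivity
  obtain ⟨μ, hμ, hcost⟩ := exists_random_tree hd hK (fun S hS => by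
    obtain ⟨T, hT, h⟩ := exists_sorting_tree S
    exact ⟨T, hT, fun x => ⟨(h x).1, (h x).2.trans (sorting_cost_le hd2 hS)⟩⟩) H subset_rfl
  let restrict : (Vec n → SignType) → (↥(H : Set (Vec n)) → SignType) := fun g h => g h
  refine ⟨⟨μ.map (LinearDecisionTree.map restrict), ?_, ?_⟩, iSup_le fun x => ?_⟩
  · intro T hT
    obtain ⟨T₀, hT₀, rfl⟩ := (PMF.mem_support_map_iff _ _ _).mp hT
    exact (hμ T₀ hT₀).1.map _
  · intro T hT x
    obtain ⟨T₀, hT₀, rfl⟩ := (PMF.mem_support_map_iff _ _ _).mp hT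
    rw [eval_map]
    exact funext fun h => (hμ T₀ hT₀).2 x h h.2
  · change expectation (μ.map (LinearDecisionTree.map restrict))
      (fun T => (T.numQueries x : ℝ≥0∞)) ≤ _
    rw [expectation_map]
    simp only [Function.comp_def, numQueries_map]
    refine (hcost x).trans (ENNReal.ofReal_le_ofReal ?_)
    have hN : (2 : ℝ) ≤ H.card := by exact_mod_cast hH
    have hlog : Real.log (1 + H.card) ≤ 2 * Real.log H.card := by
      have h1 : Real.log (1 + H.card) ≤ Real.log ((H.card : ℝ) ^ 2) :=
        Real.log_le_log (by linarith) (by nlinarith)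
      rw [Real.log_pow] at h1
      exact_mod_cast h1
    have := mul_le_mul_of_nonneg_left hlog (by linarith : 0 ≤ 4 * K)
    refine this.trans (le_of_eq ?_)
    rw [hKdef]; ring
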